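/- Let $n\ge 1$. For $p\in[1,\infty]$ let $1/p+1/p'=1$ and let $\widehat L^{p}(\mathbb R^n)$ be the space of all $f\in L^{p}(\mathbb R^n)$ that are the (distributional) Fourier transform of some $g\in L^{p'}(\mathbb R^n)$, with the norm $\|f\|_{\widehat L^{p}}=\|\widehat f\,\|_{p'}$. For a finite complex Borel measure $\mu$ on $\mathbb R^n$ put $$\|\mu\|_p^*=\sup\Big\{\Big|\int_{\mathbb R^n}h\,d\mu\Big| \;:\; h\in\widehat L^{p'}(\mathbb R^n),\ \|h\|_{\widehat L^{p'}}\le 1\Big\},$$ where $h$ runs over the elements of $\widehat L^{p'}(\mathbb R^n)$ that have a continuous representative, and that representative, required to be $|\mu|$-integrable, is used in the integral. Write $\mu\in\mathcal M_p$ if $\|\mu\|_p^*<\infty$. The Fourier–Stieltjes transform of $\mu$ is $\widehat\mu(y)=\int_{\mathbb R^n}e^{-2\pi i x\cdot y}\,d\mu(x)$. The measure $\mu$ is supported in a set $F\subset\mathbb R^n$ if $\mu(A)=0$ for every Borel set $A$ disjoint from $F$, and the function $\widehat\mu$ is supported in a set $E\subset\mathbb R^n$ if $\widehat\mu=0$ Lebesgue-almost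 everywhere outside $E$. **Theorem.** Let $\mu$ be a nonzero finite complex Borel measure on $\mathbb R^n$ with $\mu\in\mathcal M_2$. Then $\mu$ and $\widehat\mu$ cannot both be supported in sets of finite Lebesgue measure: there are no sets $E,F\subset\mathbb R^n$ of finite Lebesgue measure such that $\mu$ is supported in $F$ and $\widehat\mu$ is supported in $E$. -/

import Mathlib

open MeasureTheory
open scoped ENNReal FourierTransform SchwartzMap

noncomputable section

namespace MeasureLp

/-- The integral `∫ h dμ` of a complex function against a finite complex Borel measure on `ℝⁿ`
(the pairing is multiplication in `ℂ`). -/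
def cintegral {n : ℕ} (μ : ComplexMeasure (EuclideanSpace ℝ (Fin n)))
    (h : EuclideanSpace ℝ (Fin n) → ℂ) : ℂ :=
  ∫ᵛ x, h x ∂[ContinuousLinearMap.mul ℝ ℂ; μ]

/-- The Fourier–Stieltjes transform `μ̂(y) = ∫ exp(-2πi x·y) dμ(x)`. -/
def fourierStieltjes {n : ℕ} (μ : ComplexMeasure (EuclideanSpace ℝ (Fin n)))
    (y : EuclideanSpace ℝ (Fin n)) : ℂ :=
  cintegral μ fun x => Complex.exp (-2 * Real.pi * Complex.I * (inner ℝ x y : ℝ))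

/-- `k` is the Fourier transform of `f` in the sense of tempered distributions:
`⟨k, ψ⟩ = ⟨f, ψ̂⟩` for every Schwartz function `ψ`. It is used for `f` and `k` in
Lebesgue spaces only, so that all the integrals converge. -/
def IsFourierTransform {n : ℕ} (f k : EuclideanSpace ℝ (Fin n) → ℂ) : Prop :=
  ∀ ψ : 𝓢(EuclideanSpace ℝ (Fin n), ℂ), ∫ x, k x * ψ x = ∫ x, f x * (𝓕 ψ) x

/-- Membership in `L̂^p(ℝⁿ) = {f ∈ L^p : f = ĝ for some g ∈ L^{p'}}`, where `1/p + 1/p' = 1`. -/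
def MemHatL {n : ℕ} (p : ℝ≥0∞) (f : EuclideanSpace ℝ (Fin n) → ℂ) : Prop :=
  MemLp f p volume ∧
    ∃ g : EuclideanSpace ℝ (Fin n) → ℂ, MemLp g p.conjExponent volume ∧ IsFourierTransform g f

/-- The norm `‖f‖_{L̂^p} = ‖f̂‖_{p'}`. The transform `f̂` is unique up to null sets, so the infimum
is over a single class of functions; it is `∞` if `f̂` is not a function in `L^{p'}`. -/
def hatLNorm {n : ℕ} (p : ℝ≥0∞) (f : EuclideanSpace ℝ (Fin n) → ℂ) : ℝ≥0∞ :=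
  ⨅ (k : EuclideanSpace ℝ (Fin n) → ℂ)
    (_ : MemLp k p.conjExponent volume ∧ IsFourierTransform f k),
    eLpNorm k p.conjExponent volume

/-- The functional `‖μ‖_p^* = sup |∫ h dμ|` over `h ∈ L̂^{p'}(ℝⁿ)` with `‖h‖_{L̂^{p'}} ≤ 1`.
The measure `μ` may charge Lebesgue null sets, so the value of `∫ h dμ` depends on the
representative of `h`; the supremum is over the `h` with a continuous representative
(among them all the Schwartz functions), integrated by means of it, for which
`∫ h dμ` converges. -/
def starNorm {n : ℕ} (p : ℝ≥0∞) (μ : ComplexMeasure (EuclideanSpace ℝ (Fin n))) : ℝ≥0∞ :=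
  ⨆ (h : EuclideanSpace ℝ (Fin n) → ℂ)
    (_ : Continuous h ∧ MemHatL p.conjExponent h ∧ hatLNorm p.conjExponent h ≤ 1 ∧
      μ.Integrable h),
    ‖cintegral μ h‖ₑ

/-- Membership of a finite complex Borel measure in `𝓜_p`. -/
def MemM {n : ℕ} (p : ℝ≥0∞) (μ : ComplexMeasure (EuclideanSpace ℝ (Fin n))) : Prop :=
  starNorm p μ < ∞

/-- A measure is supported in `F` if it vanishes on the measurable sets that do not meet `F`. -/
def MeasureSupportedIn {n : ℕ} (μ : ComplexMeasure (EuclideanSpace ℝ (Fin n)))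
    (F : Set (EuclideanSpace ℝ (Fin n))) : Prop :=
  ∀ A : Set (EuclideanSpace ℝ (Fin n)), MeasurableSet A → Disjoint A F → μ A = 0

/-- A function is supported in `E` if it vanishes almost everywhere outside `E`. -/
def FunctionSupportedIn {n : ℕ} (u : EuclideanSpace ℝ (Fin n) → ℂ)
    (E : Set (EuclideanSpace ℝ (Fin n))) : Prop :=
  ∀ᵐ y ∂(volume : Measure (EuclideanSpace ℝ (Fin n))), y ∉ E → u y = 0

end MeasureLp

end


/-!
Benedicks' argument. Let `U ⊇ F` be open of finite measure and dilate so that `|U| < 1`. The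
pushforward of `exp(-2πi⟨x, ξ⟩) dμ(x)` to the torus `(ℝ/ℤ)ⁿ` has the values of `μ̂` on `ξ + ℤⁿ` as
its Fourier coefficients. Since the support of `μ̂` has finite measure, for almost every `ξ` it
contains only finitely many of these points, and then the pushforward has a trigonometric
polynomial as its density. This polynomial vanishes off the image of `U`, hence on a set of
positive measure, so by analyticity it is zero, and its zeroth coefficient is `μ̂(ξ)`. Thus
`μ̂ = 0`, and `μ = 0` by the uniqueness of Fourier–Stieltjes transforms.
-/

namespace MeasureLp.Benedicks
section Analytic

variable {F : Type*} [NormedAddCommGroup F] [NormedSpace ℝ F]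

lemma ae_ne_zero_of_analyticOnNhd_real {f : ℝ → F} (hf : AnalyticOnNhd ℝ f Set.univ) {t₀ : ℝ}
    (h₀ : f t₀ ≠ 0) : ∀ᵐ t, f t ≠ 0 := by
  rcases hf.eqOn_zero_or_eventually_ne_zero_of_preconnected isPreconnected_univ with h | h
  · exact absurd (h (Set.mem_univ t₀)) h₀
  · have := ae_restrict_le_codiscreteWithin (μ := volume) MeasurableSet.univ h
    rwa [Measure.restrict_univ] at this

variable {E : Type*} [NormedAddCommGroup E] [NormedSpace ℝ E] [FiniteDimensional ℝ E]
  [MeasurableSpace E] [BorelSpace E] (μ : Measure E) [μ.IsAddHaarMeasure]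

lemma ae_ne_zero_of_analyticOnNhd {f : E → F} (hf : AnalyticOnNhd ℝ f Set.univ) {x₀ : E}
    (h₀ : f x₀ ≠ 0) : ∀ᵐ x ∂μ, f x ≠ 0 := by
  have hcont : Continuous f := continuousOn_univ.1 hf.continuousOn
  have hcont_line : Continuous fun q : ℝ × E => f (x₀ + q.1 • q.2) := by fun_prop
  have hmeas : MeasurableSet {q : ℝ × E | f (x₀ + q.1 • q.2) ≠ 0} :=
    (isOpen_ne.preimage hcont_line).measurableSet
  have hline : ∀ y : E, ∀ᵐ t : ℝ, f (x₀ + t • y) ≠ 0 := fun y =>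
    ae_ne_zero_of_analyticOnNhd_real (t₀ := 0)
      (hf.comp (fun t _ => by fun_prop) fun _ _ => Set.mem_univ _) (by simpa using h₀)
  have hprod : ∀ᵐ t : ℝ, ∀ᵐ y ∂μ, f (x₀ + t • y) ≠ 0 :=
    (Measure.ae_ae_comm hmeas).2 (.of_forall hline)
  obtain ⟨t, ht, ht0⟩ := (hprod.and (volume.ae_ne 0)).exists
  have hdil : Measure.QuasiMeasurePreserving (fun x => t⁻¹ • (x - x₀)) μ μ :=
    (Measure.quasiMeasurePreserving_smul μ (inv_ne_zero ht0)).comp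
      (measurePreserving_sub_right μ x₀).quasiMeasurePreserving
  filter_upwards [hdil.ae ht] with x hx
  simpa only [smul_inv_smul₀ ht0, add_sub_cancel] using hx

end Analytic
section FundamentalDomain

open scoped Pointwise

variable {G α : Type*} [AddGroup G] [Countable G] [AddAction G α] [MeasurableSpace α]
  {μ : Measure α} [MeasurableConstVAdd G α] [VAddInvariantMeasure G α μ] {D : Set α}

lemma ae_finite_setOf_vadd_mem (hD : IsAddFundamentalDomain G D μ) {A : Set α} (hA : μ A ≠ ∞) :
    ∀ᵐ x ∂μ, {g : G | g +ᵥ x ∈ A}.Finite := by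
  have hsum : ∑' g : G, μ.restrict D (g +ᵥ A) ≠ ∞ := by
    simpa only [Measure.restrict_apply₀' hD.nullMeasurableSet, ← hD.measure_eq_tsum] using hA
  have hfinD : ∀ᵐ x ∂μ.restrict D, {g : G | g +ᵥ x ∈ A}.Finite := by
    filter_upwards [ae_finite_setOfPred_mem hsum] with x hx
    simpa [Set.mem_vadd_set_iff_neg_vadd_mem] using hx.neg
  have hinv (g : G) (x : α) (hx : {h : G | h +ᵥ x ∈ A}.Finite) :
      {h : G | h +ᵥ (g +ᵥ x) ∈ A}.Finite := by
    simpa only [vadd_vadd] using! hx.preimage (add_left_injective g).injOn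
  refine hD.measure_zero_of_invariant _ (fun g => ?_) ?_
  · ext x
    rw [Set.mem_vadd_set_iff_neg_vadd_mem]
    refine not_congr ⟨fun hx => ?_, hinv (-g) x⟩
    simpa only [vadd_neg_vadd] using! hinv g _ hx
  · rw [← Measure.restrict_apply₀' hD.nullMeasurableSet]
    exact hfinD

lemma measure_setOf_exists_vadd_mem_inter_le (hD : IsAddFundamentalDomain G D μ) (A : Set α) :
    μ ({x | ∃ g : G, g +ᵥ x ∈ A} ∩ D) ≤ μ A := by
  have horbits : {x | ∃ g : G, g +ᵥ x ∈ A} = ⋃ g : G, g +ᵥ A := by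
    ext x
    simp only [Set.mem_ofPred_eq, Set.mem_iUnion, Set.mem_vadd_set_iff_neg_vadd_mem]
    exact (Equiv.neg G).exists_congr_left.trans (by simp)
  rw [horbits, Set.iUnion_inter, hD.measure_eq_tsum A]
  exact measure_iUnion_le _

end FundamentalDomain

section Lattice

open Module

instance vaddInvariantMeasure_submodule {R E : Type*} [Ring R] [AddCommGroup E] [Module R E]
    [MeasurableSpace E] (μ : Measure E) [μ.IsAddLeftInvariant] (L : Submodule R E) :
    VAddInvariantMeasure L E μ :=
  inferInstanceAs (VAddInvariantMeasure L.toAddSubgroup E μ)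

lemma ae_finite_setOf_add_sum_zsmul_mem {ι E : Type*} [Fintype ι] [NormedAddCommGroup E]
    [NormedSpace ℝ E] [MeasurableSpace E] [BorelSpace E] (μ : Measure E) [μ.IsAddHaarMeasure]
    (b : Basis ι ℝ E) {A : Set E} (hA : μ A ≠ ∞) :
    ∀ᵐ x ∂μ, {m : ι → ℤ | x + ∑ i, m i • b i ∈ A}.Finite := by
  filter_upwards [ae_finite_setOf_vadd_mem (ZSpan.isAddFundamentalDomain b μ) hA] with x hx
  refine (hx.preimage (b.restrictScalars ℤ).equivFun.symm.injective.injOn).subset fun m hm => ?_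
  simpa [Basis.equivFun_symm_apply, Submodule.vadd_def, add_comm x] using hm

end Lattice


section Torus

open UnitAddTorus

instance isProbabilityMeasure_unitAddCircle :
    IsProbabilityMeasure (volume : Measure UnitAddCircle) :=
  ⟨UnitAddCircle.measure_univ⟩

variable {ι : Type*}

/-- The covering map `ℝ^ι → (ℝ/ℤ)^ι`. -/
def toTorus (x : ι → ℝ) : UnitAddTorus ι := fun i => (x i : UnitAddCircle)

lemma continuous_toTorus : Continuous (toTorus (ι := ι)) :=
  continuous_pi fun i => (AddCircle.continuous_mk' 1).comp (continuous_apply i)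

lemma surjective_toTorus : Function.Surjective (toTorus (ι := ι)) := fun t =>
  ⟨fun i => (t i).out, funext fun _ => Quotient.out_eq _⟩

lemma isOpenMap_toTorus [Finite ι] : IsOpenMap (toTorus (ι := ι)) :=
  IsOpenMap.piMap (fun _ => QuotientAddGroup.isOpenMap_coe) (by simp)

lemma toTorus_eq_toTorus_iff [Finite ι] {x y : ι → ℝ} :
    toTorus x = toTorus y ↔
      ∃ g : Submodule.span ℤ (Set.range (Pi.basisFun ℝ ι)), g +ᵥ y = x := by
  have hcoord : toTorus x = toTorus y ↔ ∀ i, ∃ m : ℤ, (m : ℝ) = x i - y i := by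
    simp only [funext_iff, toTorus]
    refine forall_congr' fun i => ?_
    rw [QuotientAddGroup.eq_iff_sub_mem, AddSubgroup.mem_zmultiples_iff]
    simp only [zsmul_one]
  have hlattice : x - y ∈ Submodule.span ℤ (Set.range (Pi.basisFun ℝ ι)) ↔
      ∀ i, ∃ m : ℤ, (m : ℝ) = x i - y i := by
    simp [(Pi.basisFun ℝ ι).mem_span_iff_repr_mem ℤ]
  simp [hcoord, ← hlattice, Submodule.vadd_def, ← eq_sub_iff_add_eq]

variable [Fintype ι]

lemma measurePreserving_toTorus :
    MeasurePreserving (toTorus (ι := ι))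
      (volume.restrict (ZSpan.fundamentalDomain (Pi.basisFun ℝ ι))) volume := by
  have hcircle : MeasurePreserving ((↑) : ℝ → UnitAddCircle) (volume.restrict (Set.Ico 0 1)) := by
    simpa [restrict_Ico_eq_restrict_Ioc] using UnitAddCircle.measurePreserving_mk 0
  rw [ZSpan.fundamentalDomain_pi_basisFun, volume_pi, Measure.restrict_pi_pi]
  exact measurePreserving_pi _ _ fun _ => hcircle

lemma volume_image_toTorus_le {U : Set (ι → ℝ)} (hU : IsOpen U) :
    volume (toTorus '' U) ≤ volume U := by
  have hD := ZSpan.isAddFundamentalDomain (Pi.basisFun ℝ ι) volume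
  have hpre : toTorus ⁻¹' (toTorus '' U) =
      {x | ∃ g : Submodule.span ℤ (Set.range (Pi.basisFun ℝ ι)), g +ᵥ x ∈ U} := by
    ext x
    simp only [Set.mem_preimage, Set.mem_image, toTorus_eq_toTorus_iff]
    aesop
  rw [← measurePreserving_toTorus.measure_preimage
      (isOpenMap_toTorus U hU).measurableSet.nullMeasurableSet,
    Measure.restrict_apply₀' hD.nullMeasurableSet, hpre]
  exact measure_setOf_exists_vadd_mem_inter_le hD U

lemma mFourier_toTorus (m : ι → ℤ) (x : ι → ℝ) :
    mFourier m (toTorus x) = 𝐞 (∑ i, m i * x i) := by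
  simp only [mFourier, toTorus, ContinuousMap.coe_mk, fourier_coe_apply, Complex.ofReal_one,
    div_one, Real.fourierChar_apply, Finset.mul_sum, Finset.sum_mul, ← Complex.exp_sum,
    Complex.ofReal_sum, Complex.ofReal_mul, Complex.ofReal_intCast]
  refine congrArg Complex.exp (Finset.sum_congr rfl fun i _ => ?_)
  push_cast
  ring

lemma integral_mFourier (m : ι → ℤ) :
    ∫ t, mFourier m t = if m = 0 then 1 else 0 := by
  split_ifs with hm
  · simp [hm, mFourier_zero]
  obtain ⟨i, hi⟩ := Function.ne_iff.1 hm
  simp only [mFourier, ContinuousMap.coe_mk, integral_fintype_prod_volume_eq_prod]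
  exact Finset.prod_eq_zero (Finset.mem_univ i) <|
    integral_eq_zero_of_add_right_eq_neg (fourier_add_half_inv_index hi zero_lt_one)

lemma analyticOnNhd_comp_toTorus {P : C(UnitAddTorus ι, ℂ)}
    (hP : P ∈ Submodule.span ℂ (Set.range mFourier)) :
    AnalyticOnNhd ℝ (fun x : ι → ℝ => P (toTorus x)) Set.univ := by
  induction hP using Submodule.span_induction with
  | mem f hf =>
    obtain ⟨m, rfl⟩ := hf
    simp only [mFourier_toTorus, Real.fourierChar_apply, ← Complex.ofRealCLM_apply]
    exact contDiff_omega_iff_analyticOnNhd.1 (by fun_prop)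
  | zero => exact analyticOnNhd_const
  | add f g _ _ hf hg => exact hf.add hg
  | smul a f _ hf => exact analyticOnNhd_const (v := a).mul hf

lemma ae_ne_zero_of_mem_span_mFourier {P : C(UnitAddTorus ι, ℂ)}
    (hP : P ∈ Submodule.span ℂ (Set.range mFourier)) (h₀ : P ≠ 0) : ∀ᵐ t, P t ≠ 0 := by
  obtain ⟨t, ht⟩ := DFunLike.ne_iff.1 h₀
  obtain ⟨x, rfl⟩ := surjective_toTorus t
  have hlift : ∀ᵐ x ∂volume.restrict (ZSpan.fundamentalDomain (Pi.basisFun ℝ ι)),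
      P (toTorus x) ≠ 0 :=
    ae_restrict_of_ae (ae_ne_zero_of_analyticOnNhd volume (analyticOnNhd_comp_toTorus hP) ht)
  rw [← measurePreserving_toTorus.map_eq]
  exact (ae_map_iff continuous_toTorus.aemeasurable
    (isOpen_ne.preimage P.continuous).measurableSet).2 hlift

end Torus

section Pushforward

open UnitAddTorus Filter Topology

variable {X Y Z : Type*} [TopologicalSpace X] [MeasurableSpace X] [BorelSpace X]
  [MeasurableSpace Y] [MeasurableSpace Z] {ν : Measure Y} {p : Y → X} {u : Y → ℂ} {ρ : Measure Z}
  {q : Z → X} {v : Z → ℂ}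

lemma tendsto_integral_apprSeq_mul [HasOuterApproxClosed X] (hp : Measurable p)
    (hu : Integrable u ν) {G : Set X} (hG : IsClosed G) :
    Tendsto (fun n => ∫ y, ((hG.apprSeq n (p y) : ℝ) : ℂ) * u y ∂ν) atTop
      (𝓝 (∫ y in p ⁻¹' G, u y ∂ν)) := by
  rw [← integral_indicator (hp hG.measurableSet)]
  refine tendsto_integral_of_dominated_convergence (fun y => ‖u y‖)
    (fun n => ?_) hu.norm (fun n => .of_forall fun y => ?_) (.of_forall fun y => ?_)
  · have hmeas : Measurable fun y => ((hG.apprSeq n (p y) : ℝ) : ℂ) := by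
      have := (hG.apprSeq n).continuous.measurable.comp hp
      fun_prop
    exact hmeas.aestronglyMeasurable.mul hu.aestronglyMeasurable
  · simpa using mul_le_of_le_one_left (norm_nonneg (u y))
      (NNReal.coe_le_one.2 (HasOuterApproxClosed.apprSeq_apply_le_one hG n (p y)))
  · have hofReal : Continuous fun r : NNReal => ((r : ℝ) : ℂ) := by fun_prop
    have hlim := tendsto_pi_nhds.1 (HasOuterApproxClosed.tendsto_apprSeq hG) (p y)
    have := ((hofReal.tendsto _).comp hlim).mul_const (u y)
    by_cases hy : p y ∈ G <;> simpa [hy, Function.comp_def] using this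

variable [CompactSpace X]

lemma integrable_continuousMap_comp_mul (hp : Measurable p) (hu : Integrable u ν)
    (f : C(X, ℂ)) : Integrable (fun y => f (p y) * u y) ν :=
  hu.bdd_mul (f.continuous.measurable.comp hp).aestronglyMeasurable
    (.of_forall fun y => f.norm_coe_le_norm (p y))

/-- The pushforward under `p` of the complex measure `u • ν`, as a functional on `C(X, ℂ)`. -/
noncomputable def pushforwardFunctional (hp : Measurable p) (hu : Integrable u ν) :
    C(X, ℂ) →L[ℂ] ℂ :=
  LinearMap.mkContinuous
    { toFun := fun f => ∫ y, f (p y) * u y ∂ν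
      map_add' := fun f g => by
        simp only [ContinuousMap.add_apply, add_mul]
        exact integral_add (integrable_continuousMap_comp_mul hp hu f)
          (integrable_continuousMap_comp_mul hp hu g)
      map_smul' := fun a f => by
        simp only [ContinuousMap.smul_apply, smul_eq_mul, mul_assoc, integral_const_mul,
          RingHom.id_apply] }
    (∫ y, ‖u y‖ ∂ν) fun f => by
      rw [mul_comm, ← integral_const_mul]
      refine norm_integral_le_of_norm_le (hu.norm.const_mul _) (.of_forall fun y => ?_)
      rw [norm_mul]
      gcongr
      exact f.norm_coe_le_norm _

lemma pushforwardFunctional_apply (hp : Measurable p) (hu : Integrable u ν) (f : C(X, ℂ)) :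
    pushforwardFunctional hp hu f = ∫ y, f (p y) * u y ∂ν := rfl

lemma setIntegral_preimage_eq_of_pushforwardFunctional_eq [HasOuterApproxClosed X]
    {hp : Measurable p} {hu : Integrable u ν} {hq : Measurable q} {hv : Integrable v ρ}
    (h : pushforwardFunctional hp hu = pushforwardFunctional hq hv) {G : Set X} (hG : IsClosed G)
    (f : C(X, ℂ)) :
    ∫ y in p ⁻¹' G, f (p y) * u y ∂ν = ∫ z in q ⁻¹' G, f (q z) * v z ∂ρ := by
  refine tendsto_nhds_unique
    (tendsto_integral_apprSeq_mul hp (integrable_continuousMap_comp_mul hp hu f) hG) ?_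
  convert tendsto_integral_apprSeq_mul hq (integrable_continuousMap_comp_mul hq hv f) hG using 2
    with n
  let g : C(X, ℂ) := ⟨fun x => ((hG.apprSeq n x : ℝ) : ℂ), by fun_prop⟩
  simpa only [pushforwardFunctional_apply, ContinuousMap.mul_apply, g, ContinuousMap.coe_mk,
    mul_assoc] using DFunLike.congr_fun h (g * f)

variable {ι : Type*} [Fintype ι]

lemma exists_mem_span_mFourier_integral_eq {c : (ι → ℤ) → ℂ} (hc : c.support.Finite) :
    ∃ P ∈ Submodule.span ℂ (Set.range (mFourier (d := ι))),
      ∀ m, ∫ t, mFourier m t * P t = c m := by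
  classical
  refine ⟨∑ k ∈ hc.toFinset, c k • mFourier (-k),
    sum_mem fun k _ => Submodule.smul_mem _ _ (Submodule.subset_span ⟨-k, rfl⟩), fun m => ?_⟩
  have hterm : ∀ k, ∫ t, mFourier m t * (c k • mFourier (-k)) t = if m = k then c k else 0 := by
    intro k
    simp only [ContinuousMap.smul_apply, smul_eq_mul, mul_left_comm _ (c k), ← mFourier_add,
      integral_const_mul, integral_mFourier]
    simp [← sub_eq_add_neg, sub_eq_zero]
  simp only [ContinuousMap.sum_apply, Finset.mul_sum]
  rw [integral_finsetSum _ fun k _ => ?_]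
  · simp only [hterm, Finset.sum_ite_eq, Set.Finite.mem_toFinset, Function.mem_support]
    exact ite_eq_left_iff.2 fun hm => (not_not.1 hm).symm
  · exact (mFourier m * c k • mFourier (-k)).continuous.integrable_of_hasCompactSupport
      (.of_compactSpace _)

lemma integral_mFourier_comp_mul_eq_zero {p : Y → UnitAddTorus ι} (hp : Measurable p)
    (hu : Integrable u ν) (hfin : {m | ∫ y, mFourier m (p y) * u y ∂ν ≠ 0}.Finite)
    {G : Set (UnitAddTorus ι)} (hG : IsClosed G) (hG₀ : volume G ≠ 0) (hpG : ∀ᵐ y ∂ν, p y ∉ G)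
    (m : ι → ℤ) : ∫ y, mFourier m (p y) * u y ∂ν = 0 := by
  obtain ⟨P, hP, hcoeff⟩ := exists_mem_span_mFourier_integral_eq hfin
  have hPint : Integrable P volume :=
    P.continuous.integrable_of_hasCompactSupport (.of_compactSpace _)
  have hpush : pushforwardFunctional hp hu = pushforwardFunctional measurable_id hPint := by
    refine ContinuousLinearMap.ext_on
      (Submodule.dense_iff_topologicalClosure_eq_top.2 span_mFourier_closure_eq_top) ?_
    rintro _ ⟨k, rfl⟩
    exact (hcoeff k).symm
  have hPG : ∫ t in G, ‖P t‖ ^ 2 = 0 := by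
    have hleft : ∫ y in p ⁻¹' G, (star P) (p y) * u y ∂ν = 0 :=
      setIntegral_measure_zero _ (measure_eq_zero_iff_ae_notMem.2 hpG)
    rw [setIntegral_preimage_eq_of_pushforwardFunctional_eq hpush hG (star P)] at hleft
    simp only [ContinuousMap.star_apply, Set.preimage_id, id_eq, RCLike.star_def,
      Complex.conj_mul'] at hleft
    exact_mod_cast hleft
  have hP_zero : ∀ᵐ t ∂volume.restrict G, P t = 0 := by
    have hsq : Integrable (fun t => ‖P t‖ ^ 2) (volume.restrict G) :=
      (by fun_prop : Continuous fun t => ‖P t‖ ^ 2).integrable_of_hasCompactSupport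
        (.of_compactSpace _)
    filter_upwards [(integral_eq_zero_iff_of_nonneg (fun t => by positivity) hsq).1 hPG] with t ht
    simpa using ht
  have hP₀ : P = 0 := by
    by_contra hne
    have hfalse : ∀ᵐ _ ∂volume.restrict G, False := by
      filter_upwards [hP_zero, ae_restrict_of_ae (ae_ne_zero_of_mem_span_mFourier hP hne)]
        with _ hzero hne_zero using hne_zero hzero
    exact hG₀ (Measure.restrict_eq_zero.1 (ae_eq_bot.1 (eventually_false_iff_eq_bot.1 hfalse)))
  simp [← hcoeff m, hP₀]

end Pushforward

section ComplexMeasure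

variable {X : Type*} [MeasurableSpace X]

instance isFiniteMeasure_variation (μ : ComplexMeasure X) : IsFiniteMeasure μ.variation := by
  have hle : μ.variation ≤ μ.re.totalVariation + μ.im.totalVariation := by
    refine VectorMeasure.variation_le_of_forall_enorm_le fun A _ => ?_
    calc ‖μ A‖ₑ = ‖((μ A).re : ℂ) + (μ A).im * Complex.I‖ₑ := by rw [Complex.re_add_im]
      _ ≤ ‖(μ A).re‖ₑ + ‖(μ A).im‖ₑ := (enorm_add_le _ _).trans_eq (by simp [← ofReal_norm])
      _ ≤ μ.re.totalVariation A + μ.im.totalVariation A :=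
        add_le_add (μ.re.enorm_le_totalVariation A) (μ.im.enorm_le_totalVariation A)
  exact isFiniteMeasure_of_le _ hle

lemma withDensityᵥ_rnDeriv_eq (μ : ComplexMeasure X) (ν : Measure X) [SigmaFinite ν]
    (h : μ ≪ᵥ ν.toENNRealVectorMeasure) : ν.withDensityᵥ (μ.rnDeriv ν) = μ := by
  obtain ⟨hre, him⟩ := (μ.absolutelyContinuous_ennreal_iff _).1 h
  have hint := μ.integrable_rnDeriv ν
  ext A hA : 1
  rw [withDensityᵥ_apply hint hA]
  refine Complex.ext ?_ ?_
  · refine (integral_re hint.integrableOn).symm.trans ?_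
    have := DFunLike.congr_fun (SignedMeasure.withDensityᵥ_rnDeriv_eq _ _ hre) A
    rwa [withDensityᵥ_apply (μ.re.integrable_rnDeriv ν) hA] at this
  · refine (integral_im hint.integrableOn).symm.trans ?_
    have := DFunLike.congr_fun (SignedMeasure.withDensityᵥ_rnDeriv_eq _ _ him) A
    rwa [withDensityᵥ_apply (μ.im.integrable_rnDeriv ν) hA] at this

lemma withDensityᵥ_rnDeriv_variation (μ : ComplexMeasure X) :
    μ.variation.withDensityᵥ (μ.rnDeriv μ.variation) = μ :=
  withDensityᵥ_rnDeriv_eq μ _ <| VectorMeasure.AbsolutelyContinuous.mk fun A hA h₀ => by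
    rw [Measure.toENNRealVectorMeasure_apply_measurable hA] at h₀
    simpa [h₀] using μ.enorm_measure_le_variation A

lemma eq_zero_of_ae_rnDeriv_variation_eq_zero {μ : ComplexMeasure X}
    (h : μ.rnDeriv μ.variation =ᵐ[μ.variation] 0) : μ = 0 := by
  rw [← withDensityᵥ_rnDeriv_variation μ, WithDensityᵥEq.congr_ae h, withDensityᵥ_zero]

variable {E F G : Type*} [NormedAddCommGroup E] [NormedSpace ℝ E] [NormedAddCommGroup F]
  [NormedSpace ℝ F] [CompleteSpace F] [NormedAddCommGroup G] [NormedSpace ℝ G]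
  {ν : Measure X} {w : X → F} {f : X → E}

lemma lintegral_enorm_apply_le (B : E →L[ℝ] F →L[ℝ] G) (hw : Integrable w ν) (f : X → E) :
    ∫⁻ x, ‖B (f x) (w x)‖ₑ ∂ν ≤ ‖B‖ₑ * ∫⁻ x, ‖f x‖ₑ ∂(ν.withDensityᵥ w).variation := by
  rw [Measure.variation_withDensityᵥ hw,
    lintegral_withDensity_eq_lintegral_mul_non_measurable₀ _ hw.aestronglyMeasurable.enorm
      (.of_forall fun _ => enorm_lt_top), ← lintegral_const_mul' _ _ enorm_ne_top]
  refine lintegral_mono fun x => ?_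
  calc ‖B (f x) (w x)‖ₑ ≤ ‖B‖ₑ * ‖f x‖ₑ * ‖w x‖ₑ := B.le_opENorm₂ _ _
    _ = ‖B‖ₑ * (‖w x‖ₑ * ‖f x‖ₑ) := by ring

lemma integrable_apply_of_integrable_withDensityᵥ (B : E →L[ℝ] F →L[ℝ] G) (hw : Integrable w ν)
    (hf : (ν.withDensityᵥ w).Integrable f) : Integrable (fun x => B (f x) (w x)) ν := by
  have hwf : Integrable (fun x => ‖w x‖ • f x) ν := by
    rw [VectorMeasure.Integrable, Measure.variation_withDensityᵥ hw,
      integrable_withDensity_iff_integrable_smul₀' hw.aestronglyMeasurable.enorm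
        (.of_forall fun _ => enorm_lt_top)] at hf
    simpa only [toReal_enorm] using hf
  have hdir : AEStronglyMeasurable (fun x => ‖w x‖⁻¹ • w x) ν :=
    hw.aestronglyMeasurable.norm.inv₀.smul hw.aestronglyMeasurable
  refine ⟨(B.aestronglyMeasurable_comp₂ hwf.aestronglyMeasurable hdir).congr
    (.of_forall fun x => ?_), ?_⟩
  · by_cases hx : w x = 0 <;> simp [hx, smul_smul]
  · exact (lintegral_enorm_apply_le B hw f).trans_lt
      (ENNReal.mul_lt_top enorm_lt_top hf.hasFiniteIntegral)

lemma edist_integral_apply_le (B : E →L[ℝ] F →L[ℝ] G) (hw : Integrable w ν) {f g : X → E}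
    (hf : (ν.withDensityᵥ w).Integrable f) (hg : (ν.withDensityᵥ w).Integrable g) :
    edist (∫ x, B (f x) (w x) ∂ν) (∫ x, B (g x) (w x) ∂ν) ≤
      ‖B‖ₑ * ∫⁻ x, ‖f x - g x‖ₑ ∂(ν.withDensityᵥ w).variation := by
  rw [edist_eq_enorm_sub, ← integral_sub (integrable_apply_of_integrable_withDensityᵥ B hw hf)
    (integrable_apply_of_integrable_withDensityᵥ B hw hg)]
  simp only [← _root_.sub_apply, ← map_sub]
  exact (enorm_integral_le_lintegral_enorm _).trans
    (lintegral_enorm_apply_le B hw fun x => f x - g x)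

lemma integral_withDensityᵥ [CompleteSpace G] (B : E →L[ℝ] F →L[ℝ] G) (hw : Integrable w ν)
    (hf : (ν.withDensityᵥ w).Integrable f) :
    ∫ᵛ x, f x ∂[B; ν.withDensityᵥ w] = ∫ x, B (f x) (w x) ∂ν := by
  have hint {f : X → E} (hf : (ν.withDensityᵥ w).Integrable f) :=
    integrable_apply_of_integrable_withDensityᵥ B hw hf
  refine Integrable.induction
    (fun f => ∫ᵛ x, f x ∂[B; ν.withDensityᵥ w] = ∫ x, B (f x) (w x) ∂ν) ?_ ?_ ?_ ?_ hf
  · intro e s hs hfin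
    have hind (x : X) : B (s.indicator (fun _ => e) x) (w x) =
        s.indicator (fun x => B e (w x)) x := by
      by_cases hx : x ∈ s <;> simp [hx]
    rw [VectorMeasure.integral_eq_setToFun, setToFun_indicator_const _ hs hfin.ne]
    simp only [hind, integral_indicator hs,
      ContinuousLinearMap.integral_comp_comm _ hw.integrableOn]
    rw [← withDensityᵥ_apply hw hs]
    rfl
  · intro f g _ hf hg hf' hg'
    simp only [Pi.add_apply, map_add, _root_.add_apply]
    rw [VectorMeasure.integral_fun_add hf hg, hf', hg', integral_add (hint hf) (hint hg)]
  · have hlip : LipschitzWith ‖B‖₊ fun f : Lp E 1 (ν.withDensityᵥ w).variation =>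
        ∫ x, B (f x) (w x) ∂ν := fun f g => by
      rw [Lp.edist_def, eLpNorm_one_eq_lintegral_enorm]
      exact edist_integral_apply_le B hw (L1.integrable_coeFn f) (L1.integrable_coeFn g)
    exact isClosed_eq VectorMeasure.continuous_integral hlip.continuous
  · intro f g hfg hf hf'
    have hdist := edist_integral_apply_le B hw hf (hf.congr hfg)
    rw [lintegral_congr_ae (hfg.mono fun x hx => by rw [hx, sub_self, enorm_zero]),
      lintegral_zero, mul_zero, nonpos_iff_eq_zero, edist_eq_zero] at hdist
    rw [← VectorMeasure.integral_congr_ae hfg, hf', hdist]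

end ComplexMeasure

section Uniqueness

variable {V : Type*} [NormedAddCommGroup V] [InnerProductSpace ℝ V] [FiniteDimensional ℝ V]
  [MeasurableSpace V] [BorelSpace V] {ν : Measure V} [SigmaFinite ν]
  {E : Type*} [NormedAddCommGroup E] [NormedSpace ℂ E] [CompleteSpace E] {w : V → E}

lemma integral_fourier_smul_eq (hw : Integrable w ν) (ψ : 𝓢(V, ℂ)) :
    ∫ x, 𝓕 ψ x • w x ∂ν = ∫ ξ, ψ ξ • VectorFourier.fourierIntegral 𝐞 ν (innerₗ V) w ξ := by
  have := VectorFourier.integral_fourierIntegral_smul_eq_flip (L := innerₗ V)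
    Real.continuous_fourierChar continuous_inner (ψ.integrable (μ := volume)) hw
  rwa [flip_innerₗ] at this

lemma ae_eq_zero_of_fourierIntegral_eq_zero (hw : Integrable w ν)
    (h : VectorFourier.fourierIntegral 𝐞 ν (innerₗ V) w = 0) : ∀ᵐ x ∂ν, w x = 0 := by
  refine ae_eq_zero_of_integral_contDiff_smul_eq_zero hw.locallyIntegrable fun g hg hgc => ?_
  have hgc' : HasCompactSupport fun x => (g x : ℂ) := hgc.comp_left Complex.ofReal_zero
  let φ : 𝓢(V, ℂ) := hgc'.toSchwartzMap (Complex.ofRealCLM.contDiff.comp hg)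
  calc ∫ x, g x • w x ∂ν = ∫ x, 𝓕 (𝓕⁻ φ) x • w x ∂ν := by
        rw [FourierTransform.fourier_fourierInv_eq]
        exact integral_congr_ae (.of_forall fun x => (Complex.coe_smul (g x) (w x)).symm)
    _ = 0 := by simp only [integral_fourier_smul_eq hw, h, Pi.zero_apply, smul_zero, integral_zero]

end Uniqueness

section Benedicks

open scoped Pointwise
open UnitAddTorus Filter Topology

lemma exists_pos_measure_smul_lt {E : Type*} [NormedAddCommGroup E] [NormedSpace ℝ E]
    [FiniteDimensional ℝ E] [Nontrivial E] [MeasurableSpace E] [BorelSpace E] (μ : Measure E)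
    [μ.IsAddHaarMeasure] {U : Set E} (hU : μ U ≠ ∞) {ε : ℝ≥0∞} (hε : ε ≠ 0) :
    ∃ c : ℝ, 0 < c ∧ μ (c • U) < ε := by
  have hlim : Tendsto (fun c : ℝ => ENNReal.ofReal |c ^ Module.finrank ℝ E| * μ U) (𝓝[>] 0)
      (𝓝 0) := by
    have hpow : Continuous fun c : ℝ => ENNReal.ofReal |c ^ Module.finrank ℝ E| :=
      ENNReal.continuous_ofReal.comp (by fun_prop)
    have := ENNReal.Tendsto.mul_const (hpow.tendsto 0) (.inr hU)
    rw [zero_pow Module.finrank_pos.ne', abs_zero, ENNReal.ofReal_zero, zero_mul] at this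
    exact this.mono_left nhdsWithin_le_nhds
  obtain ⟨c, hc, hlt⟩ :=
    (eventually_mem_nhdsWithin.and (hlim.eventually_lt_const (pos_iff_ne_zero.2 hε))).exists
  exact ⟨c, hc, by rwa [Measure.addHaar_smul]⟩

variable {ι : Type*} [Fintype ι] {ν : Measure (EuclideanSpace ℝ ι)} {w : EuclideanSpace ℝ ι → ℂ}

lemma volume_image_toTorus_ofLp_le {U : Set (EuclideanSpace ℝ ι)} (hU : IsOpen U) :
    volume ((fun x => toTorus (WithLp.ofLp x)) '' U) ≤ volume U := by
  have himage : WithLp.ofLp '' U = WithLp.toLp 2 ⁻¹' U :=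
    (WithLp.equiv 2 (ι → ℝ)).image_eq_preimage_symm U
  rw [← Set.image_image toTorus WithLp.ofLp, himage,
    ← (PiLp.volume_preserving_toLp ι).measure_preimage hU.measurableSet.nullMeasurableSet]
  exact volume_image_toTorus_le (hU.preimage (PiLp.continuous_toLp 2 _))

lemma integral_mFourier_toTorus_mul_eq_fourierIntegral (c : ℝ) (ξ : EuclideanSpace ℝ ι)
    (m : ι → ℤ) :
    ∫ x, mFourier m (toTorus (WithLp.ofLp (c • x))) * (𝐞 (-inner ℝ x ξ) • w x) ∂ν =
      VectorFourier.fourierIntegral 𝐞 ν (innerₗ _) w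
        (ξ + ∑ i, (-m) i • c • EuclideanSpace.basisFun ι ℝ i) := by
  refine integral_congr_ae (.of_forall fun x => ?_)
  have hinner : inner ℝ x (∑ i, (-m) i • c • EuclideanSpace.basisFun ι ℝ i) =
      -∑ i, m i * WithLp.ofLp (c • x) i := by
    simp [inner_sum, ← Int.cast_smul_eq_zsmul ℝ, inner_smul_right]
  simp only [innerₗ_apply_apply, inner_add_right, hinner, mFourier_toTorus, neg_add, neg_neg]
  rw [add_comm (-_), AddChar.map_add_eq_mul, mul_smul]
  rfl

lemma fourierIntegral_eq_zero_of_finite (hw : Integrable w ν) {U : Set (EuclideanSpace ℝ ι)}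
    (hU : IsOpen U) (hνU : ∀ᵐ x ∂ν, x ∈ U) {c : ℝ} (hc : c ≠ 0) (hcU : volume (c • U) < 1)
    {ξ : EuclideanSpace ℝ ι}
    (hξ : {m : ι → ℤ | VectorFourier.fourierIntegral 𝐞 ν (innerₗ _) w
      (ξ + ∑ i, m i • c • EuclideanSpace.basisFun ι ℝ i) ≠ 0}.Finite) :
    VectorFourier.fourierIntegral 𝐞 ν (innerₗ _) w ξ = 0 := by
  let p (x : EuclideanSpace ℝ ι) : UnitAddTorus ι := toTorus (WithLp.ofLp (c • x))
  let u (x : EuclideanSpace ℝ ι) : ℂ := 𝐞 (-inner ℝ x ξ) • w x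
  have hp : Measurable p := (continuous_toTorus.comp (by fun_prop)).measurable
  have hu : Integrable u ν :=
    (VectorFourier.fourierIntegral_convergent_iff Real.continuous_fourierChar
      (L := innerₗ _) continuous_inner ξ).2 hw
  have hcoeff (m : ι → ℤ) : ∫ x, mFourier m (p x) * u x ∂ν = _ :=
    integral_mFourier_toTorus_mul_eq_fourierIntegral c ξ m
  have hV : IsOpen ((fun x => toTorus (WithLp.ofLp x)) '' (c • U)) := by
    rw [← Set.image_image toTorus WithLp.ofLp]
    exact isOpenMap_toTorus _ ((PiLp.homeomorph 2 _).isOpenMap _ (hU.smul₀ hc))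
  have hV₁ : volume ((fun x => toTorus (WithLp.ofLp x)) '' (c • U)) < 1 :=
    (volume_image_toTorus_ofLp_le (hU.smul₀ hc)).trans_lt hcU
  have hzero := integral_mFourier_comp_mul_eq_zero hp hu ?_ hV.isClosed_compl ?_ ?_ 0
  · simpa [hcoeff] using hzero
  · simp only [hcoeff]
    exact hξ.preimage neg_injective.injOn
  · rw [measure_compl hV.measurableSet hV₁.ne_top, measure_univ]
    exact (tsub_pos_of_lt hV₁).ne'
  · filter_upwards [hνU] with x hx
    exact not_not.2 (Set.mem_image_of_mem _ (Set.smul_mem_smul_set hx))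

theorem ae_eq_zero_of_volume_support_fourierIntegral [Nonempty ι] [SigmaFinite ν]
    (hw : Integrable w ν) {F : Set (EuclideanSpace ℝ ι)} (hF : volume F ≠ ∞) (hνF : ∀ᵐ x ∂ν, x ∈ F)
    (hE : volume (Function.support (VectorFourier.fourierIntegral 𝐞 ν (innerₗ _) w)) ≠ ∞) :
    ∀ᵐ x ∂ν, w x = 0 := by
  obtain ⟨U, hFU, hU, hUtop⟩ := F.exists_isOpen_lt_of_lt _ hF.lt_top
  obtain ⟨c, hc, hcU⟩ := exists_pos_measure_smul_lt volume hUtop.ne one_ne_zero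
  let b := (EuclideanSpace.basisFun ι ℝ).toBasis.unitsSMul fun _ => Units.mk0 c hc.ne'
  have hb (i : ι) : b i = c • EuclideanSpace.basisFun ι ℝ i := by
    simp [b, Module.Basis.unitsSMul_apply]
  have hae : VectorFourier.fourierIntegral 𝐞 ν (innerₗ _) w =ᵐ[volume] 0 := by
    filter_upwards [ae_finite_setOf_add_sum_zsmul_mem volume b hE] with ξ hξ
    simp only [hb] at hξ
    exact fourierIntegral_eq_zero_of_finite hw hU (hνF.mono hFU) hc.ne' hcU hξ
  have hcont : Continuous (VectorFourier.fourierIntegral 𝐞 ν (innerₗ _) w) :=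
    VectorFourier.fourierIntegral_continuous Real.continuous_fourierChar continuous_inner hw
  exact ae_eq_zero_of_fourierIntegral_eq_zero hw
    ((hcont.ae_eq_iff_eq volume continuous_zero).1 hae)

end Benedicks

section FourierStieltjes

variable {n : ℕ} {μ : ComplexMeasure (EuclideanSpace ℝ (Fin n))}

lemma fourierStieltjes_eq_fourierIntegral_rnDeriv (μ : ComplexMeasure (EuclideanSpace ℝ (Fin n))) :
    fourierStieltjes μ =
      VectorFourier.fourierIntegral 𝐞 μ.variation (innerₗ _) (μ.rnDeriv μ.variation) := by
  ext y
  have hchar (x : EuclideanSpace ℝ (Fin n)) :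
      Complex.exp (-2 * Real.pi * Complex.I * (inner ℝ x y : ℝ)) = 𝐞 (-inner ℝ x y) := by
    rw [Real.fourierChar_apply]
    push_cast
    ring_nf
  have hint : μ.Integrable fun x => (𝐞 (-inner ℝ x y) : ℂ) :=
    .of_bound (by fun_prop) 1 (.of_forall fun x => (Circle.norm_coe _).le)
  calc fourierStieltjes μ y
      = ∫ᵛ x, (𝐞 (-inner ℝ x y) : ℂ) ∂[ContinuousLinearMap.mul ℝ ℂ;
          μ.variation.withDensityᵥ (μ.rnDeriv μ.variation)] := by
        rw [withDensityᵥ_rnDeriv_variation, fourierStieltjes, cintegral]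
        simp only [hchar]
    _ = ∫ x, (𝐞 (-inner ℝ x y) : ℂ) * μ.rnDeriv μ.variation x ∂μ.variation :=
        integral_withDensityᵥ _ (μ.integrable_rnDeriv _)
          (by rwa [withDensityᵥ_rnDeriv_variation])

lemma ae_variation_mem_of_measureSupportedIn {F U : Set (EuclideanSpace ℝ (Fin n))}
    (hμF : MeasureSupportedIn μ F) (hU : MeasurableSet U) (hFU : F ⊆ U) :
    ∀ᵐ x ∂μ.variation, x ∈ U :=
  (VectorMeasure.variation_apply_eq_zero hU.compl).2 fun A hAU hA =>
    hμF A hA (disjoint_compl_left.mono hAU hFU)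

end FourierStieltjes

end MeasureLp.Benedicks

open MeasureLp MeasureLp.Benedicks in
theorem mainTheorem2_general {n : ℕ} (hn : 1 ≤ n)
    {μ : ComplexMeasure (EuclideanSpace ℝ (Fin n))} {F E : Set (EuclideanSpace ℝ (Fin n))}
    (hF : volume F < ⊤) (hμF : MeasureSupportedIn μ F) (hE : volume E < ⊤)
    (hμE : FunctionSupportedIn (fourierStieltjes μ) E) : μ = 0 := by
  have : Nonempty (Fin n) := Fin.pos_iff_nonempty.1 hn
  have hsupport : volume (Function.support (fourierStieltjes μ)) ≠ ∞ :=
    ((measure_mono_ae (hμE.mono fun _ h => not_imp_comm.1 h)).trans_lt hE).ne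
  rw [fourierStieltjes_eq_fourierIntegral_rnDeriv] at hsupport
  exact eq_zero_of_ae_rnDeriv_variation_eq_zero <|
    ae_eq_zero_of_volume_support_fourierIntegral (μ.integrable_rnDeriv _)
      ((measure_toMeasurable F).trans_ne hF.ne)
      (ae_variation_mem_of_measureSupportedIn hμF (measurableSet_toMeasurable _ _)
        (subset_toMeasurable _ _)) hsupport

theorem mainTheorem2 (n : ℕ) (hn : 1 ≤ n)
    (μ : MeasureTheory.ComplexMeasure (EuclideanSpace ℝ (Fin n)))
    (hμM : MeasureLp.MemM 2 μ) (hμ : μ ≠ 0) :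
    ¬ ((∃ F : Set (EuclideanSpace ℝ (Fin n)),
          MeasureTheory.volume F < ⊤ ∧ MeasureLp.MeasureSupportedIn μ F) ∧
       (∃ E : Set (EuclideanSpace ℝ (Fin n)),
          MeasureTheory.volume E < ⊤ ∧
            MeasureLp.FunctionSupportedIn (MeasureLp.fourierStieltjes μ) E)) := by
  rintro ⟨⟨F, hF, hμF⟩, E, hE, hμE⟩
  exact hμ (mainTheorem2_general hn hF hμF hE hμE)
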